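/- Let $\mathcal R$ be the cone of infinite distance matrices, i.e. of real matrices $r=(r_{i,j})_{i,j\ge 1}$ with $r_{i,i}=0$, $r_{i,j}=r_{j,i}\ge 0$ and $r_{i,j}\le r_{i,k}+r_{k,j}$ for all $i,j,k$; $r$ is called proper if $r_{i,j}\ne 0$ for $i\ne j$. For a distance matrix $q$ of order $n$ let $A(q)=\{a\in\mathbb R^n : |a_i-a_j|\le q_{i,j}\le a_i+a_j \text{ for all } i,j\}$. A matrix $r\in\mathcal R$ is called universal if for every $\varepsilon>0$, every $n$ and every $a\in A\big((r_{i,j})_{i,j\le n}\big)$ there is an $m$ with $\max_{i\le n}|r_{i,m}-a_i|<\varepsilon$. Let $\gamma$ be an atomless (continuous) Borel probability measure on $[0,\infty)$ whose support is all of $[0,\infty)$. Let $\nu_\gamma$ be the law of the random matrix $r\in\mathcal R$ whose entries above the diagonal are chosen one after another in the order $r_{1,2},\ r_{1,3},\ r_{2,3},\ r_{1,4},\ r_{2,4},\ r_{3,4},\dots$ so that each $r_{1,n}$, $n\ge 2$, has distribution $\gamma$ and is independent of the entries chosen before it, and, for $1\le k<n-1$, the conditional distribution of $r_{k+1,n}$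 given the entries chosen before it is the normalized Lebesgue measure on the segment $\big[\max_{i\le k}|r_{i,k+1}-r_{i,n}|,\ \min_{i\le k}(r_{i,k+1}+r_{i,n})\big]$ of the values allowed by the triangle inequality (the unit mass at the point if the segment is a point). Then $\nu_\gamma$ is a probability measure on $\mathcal R$, and $\nu_\gamma$-almost every matrix $r$ is proper and universal. Consequently, for $\nu_\gamma$-almost every $r$ the completion of the set of positive integers with respect to the metric $r$ is isometric to the Urysohn space: it is a complete separable metric space which contains an isometric copy of every complete separable metric space and in which every isometry between two finite subsets extends to an isometry of the whole space onto itself, and it is isometric to every other metric space with these properties. -/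

import Mathlib

open MeasureTheory ProbabilityTheory Set
open scoped NNReal ENNReal

noncomputable section

namespace RandomMetric

/-! ### Distance matrices

The positive integers `1, 2, 3, …` are represented by the natural numbers `0, 1, 2, …`. -/

/-- The cone of infinite distance matrices (zeros off the diagonal are allowed). -/
def distCone : Set (ℕ → ℕ → ℝ) :=
  {r | (∀ i, r i i = 0) ∧ (∀ i j, 0 ≤ r i j) ∧ (∀ i j, r i j = r j i) ∧
    ∀ i j k, r i j ≤ r i k + r k j}

/-- A distance matrix is proper if it has no zeros outside the main diagonal. -/
def IsProper (r : distCone) : Prop := ∀ i j, i ≠ j → r.1 i j ≠ 0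

/-- The north-west corner of order `n`. -/
def corner (n : ℕ) (r : ℕ → ℕ → ℝ) : Fin n → Fin n → ℝ := fun i j => r i j

/-- The set `A(q)` of admissible vectors of a distance matrix `q` of order `n`. -/
def admissible {n : ℕ} (q : Fin n → Fin n → ℝ) : Set (Fin n → ℝ) :=
  {a | ∀ i j, |a i - a j| ≤ q i j ∧ q i j ≤ a i + a j}

/-- Universal distance matrices. -/
def IsUniversal (r : distCone) : Prop :=
  ∀ ε : ℝ, 0 < ε → ∀ n : ℕ, ∀ a ∈ admissible (corner n r.1),
    ∃ m : ℕ, ∀ i : Fin n, |r.1 i m - a i| < ε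

/-! ### The (semi)metric on the integers given by a distance matrix -/

/-- The set of positive integers, to be equipped with the semimetric given by `r`. -/
def Points (_r : distCone) : Type := ℕ

instance (r : distCone) : PseudoMetricSpace (Points r) where
  dist := fun i j : ℕ => r.1 i j
  dist_self := r.2.1
  dist_comm := r.2.2.2.1
  dist_triangle := fun i j k => r.2.2.2.2 i k j

/-- The completion of the integers in the (semi)metric `r`, a metric space; points at distance
zero are identified. -/
abbrev Completed (r : distCone) : Type := UniformSpace.Completion (Points r)

/-! ### The Urysohn space -/

/-- `U` is the Urysohn space: a Polish (complete separable metric) space which is universal, i.e.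
contains an isometric copy of every Polish space, and homogeneous, i.e. every isometry between
finite subsets is induced by an isometry of `U` onto itself. Every Polish space is isometric to
one whose underlying type is in `Type`, so it is enough to consider these. -/
structure IsUrysohn (U : Type*) [MetricSpace U] : Prop where
  complete : CompleteSpace U
  separable : TopologicalSpace.SeparableSpace U
  universal : ∀ (X : Type) [MetricSpace X] [CompleteSpace X] [TopologicalSpace.SeparableSpace X],
    ∃ f : X → U, Isometry f
  homogeneous : ∀ (m : ℕ) (a b : Fin m → U), (∀ i j, dist (a i) (a j) = dist (b i) (b j)) →
    ∃ J : U ≃ᵢ U, ∀ i, J (a i) = b i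

/-! ### The measure of the random distance matrix -/

/-- The Lebesgue measure on the segment `[a, b]` normalized to one; the unit mass at `a` if the
segment degenerates to a point. (The value for `b < a` is irrelevant.) -/
def unif (a b : ℝ) : Measure ℝ :=
  if a < b then (volume (Icc a b))⁻¹ • volume.restrict (Icc a b) else Measure.dirac a

theorem measurable_unif : Measurable fun p : ℝ × ℝ => unif p.1 p.2 := by
  unfold unif
  refine Measurable.ite (measurableSet_lt measurable_fst measurable_snd) ?_
    (Measure.measurable_dirac.comp measurable_fst)
  refine Measure.measurable_of_measurable_coe _ fun s hs => ?_
  simp only [Measure.smul_apply, smul_eq_mul, Measure.restrict_apply hs, Real.volume_Icc]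
  refine Measurable.mul (by fun_prop) ?_
  have hS : MeasurableSet {q : (ℝ × ℝ) × ℝ | q.2 ∈ s ∧ q.1.1 ≤ q.2 ∧ q.2 ≤ q.1.2} :=
    (measurable_snd hs).inter
      ((measurableSet_le (measurable_fst.comp measurable_fst) measurable_snd).inter
        (measurableSet_le measurable_snd (measurable_snd.comp measurable_fst)))
  exact measurable_measure_prodMk_left (ν := (volume : Measure ℝ)) hS

/-- `unif` as a Markov kernel from pairs of endpoints. -/
def unifKernel : Kernel (ℝ × ℝ) ℝ := ⟨fun p => unif p.1 p.2, measurable_unif⟩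

instance : IsMarkovKernel unifKernel := by
  refine ⟨fun p => ⟨?_⟩⟩
  change unif p.1 p.2 univ = 1
  unfold unif
  split_ifs with h
  · have h0 : ENNReal.ofReal (p.2 - p.1) ≠ 0 := by simpa using h
    simp [Real.volume_Icc, ENNReal.inv_mul_cancel h0 ENNReal.ofReal_ne_top]
  · simp

/-- The least value of `r (k+1) n` that the triangle inequality allows, given the entries `r i j`
with `i, j < n` and `r i n` with `i ≤ k`. -/
def lower (k n : ℕ) (r : ℕ → ℕ → ℝ) : ℝ :=
  (Finset.range (k + 1)).sup' Finset.nonempty_range_add_one fun i => |r i (k + 1) - r i n|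

/-- The greatest such value. -/
def upper (k n : ℕ) (r : ℕ → ℕ → ℝ) : ℝ :=
  (Finset.range (k + 1)).inf' Finset.nonempty_range_add_one fun i => r i (k + 1) + r i n

theorem measurable_bounds (k n : ℕ) :
    Measurable fun r : ℕ → ℕ → ℝ => (lower k n r, upper k n r) := by
  have hl : Measurable (lower k n) := by
    unfold lower
    exact Finset.measurable_range_sup'' fun i _ => by fun_prop
  have hu : Measurable (upper k n) := by
    have : upper k n = (Finset.range (k + 1)).inf' Finset.nonempty_range_add_one
        fun i (r : ℕ → ℕ → ℝ) => r i (k + 1) + r i n := by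
      ext r; simp [upper, Finset.inf'_apply]
    rw [this]
    exact Finset.inf'_induction _ _ (fun f hf g hg => hf.inf hg) fun i _ => by fun_prop
  exact hl.prodMk hu

/-- The conditional distribution of the entry `r i j`, `i < j`, given the entries of `r` that
precede it: in the first row it is `γ`, independently of these entries, and in the other rows it
is uniform on the segment of all the values allowed by the triangle inequality. -/
def entryKernel (γ : Measure ℝ≥0) : ℕ → ℕ → Kernel (ℕ → ℕ → ℝ) ℝ
  | 0, _ => Kernel.const _ (γ.map ((↑) : ℝ≥0 → ℝ))
  | k + 1, j => unifKernel.comap (fun r => (lower k j r, upper k j r)) (measurable_bounds k j)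

/-- The entries above the diagonal in the order in which they are chosen, column by column:
`(0,1), (0,2), (1,2), (0,3), (1,3), (2,3), …`. -/
def entryAt : ℕ → ℕ × ℕ
  | 0 => (0, 1)
  | t + 1 => if (entryAt t).1 + 1 < (entryAt t).2 then ((entryAt t).1 + 1, (entryAt t).2)
      else (0, (entryAt t).2 + 1)

/-- The position of the entry `(i, j)`, `i < j`, in this order. -/
def entryIndex (i j : ℕ) : ℕ := j.choose 2 + i

/-- The symmetric matrix with zero diagonal with the given sequence of entries. -/
def toMatrix (x : ℕ → ℝ) : ℕ → ℕ → ℝ := fun i j =>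
  if i < j then x (entryIndex i j) else if j < i then x (entryIndex j i) else 0

/-- The matrix fragment given by the entries chosen up to time `t`; the entries not yet chosen are
set to zero, and they are never used. -/
def fragment (t : ℕ) (x : (s : Finset.Iic t) → ℝ) : ℕ → ℕ → ℝ :=
  toMatrix fun s => if h : s ∈ Finset.Iic t then x ⟨s, h⟩ else 0

theorem measurable_toMatrix : Measurable toMatrix := by
  refine measurable_pi_lambda _ fun i => measurable_pi_lambda _ fun j => ?_
  unfold toMatrix
  split_ifs <;> fun_prop

theorem measurable_fragment (t : ℕ) : Measurable (fragment t) := by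
  refine measurable_toMatrix.comp (measurable_pi_lambda _ fun s => ?_)
  split_ifs <;> fun_prop

/-- The conditional distribution of the entry chosen at time `t + 1`, given those chosen up to
time `t`. -/
def stepKernel (γ : Measure ℝ≥0) (t : ℕ) : Kernel ((s : Finset.Iic t) → ℝ) ℝ :=
  (entryKernel γ (entryAt (t + 1)).1 (entryAt (t + 1)).2).comap (fragment t)
    (measurable_fragment t)

instance (γ : Measure ℝ≥0) [IsProbabilityMeasure γ] (i j : ℕ) :
    IsMarkovKernel (entryKernel γ i j) := by
  have : IsProbabilityMeasure (γ.map ((↑) : ℝ≥0 → ℝ)) :=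
    Measure.isProbabilityMeasure_map (by fun_prop)
  cases i <;> (unfold entryKernel; infer_instance)

instance (γ : Measure ℝ≥0) [IsProbabilityMeasure γ] (t : ℕ) :
    IsMarkovKernel (stepKernel γ t) := by
  unfold stepKernel; infer_instance

/-- The law of the sequence of entries: the first one has distribution `γ`, and each of the
following ones is chosen according to `stepKernel`. -/
def entryLaw (γ : Measure ℝ≥0) [IsProbabilityMeasure γ] : Measure (ℕ → ℝ) :=
  Kernel.trajMeasure (X := fun _ => ℝ) (γ.map ((↑) : ℝ≥0 → ℝ)) (stepKernel γ)

/-- The measure `ν_γ` on the cone of distance matrices: the law of the random matrix with these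
entries, regarded as a measure on the cone. -/
def nu (γ : Measure ℝ≥0) [IsProbabilityMeasure γ] : Measure distCone :=
  ((entryLaw γ).map toMatrix).comap Subtype.val

end RandomMetric

end

noncomputable section

namespace RandomMetric

open Filter Topology

/-! The argument has a deterministic and a probabilistic half.

Deterministic half: universality of `r` lets every one-point metric extension of a finite subset of
the completion be realized approximately (`IsUniversal.approxExtension`), and completeness makes the
realization exact (`ApproxExtension.onePointExtension`). Exact one-point extension gives embeddings
of Polish spaces by going forth along a dense sequence, and homogeneity by going back and forth.
Conversely, `IsUrysohn` implies one-point extension, so the same back-and-forth yields uniqueness.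

Probabilistic half: the prescribed segments are never empty, so the matrix is almost surely a
distance matrix (`mem_distCone_of_mem_segment`). Fix a vector `b` and suppose the corner almost
admits it. In a new column the first entry is near `b 0` with positive probability, as `γ` has full
support. After that each segment contains a point near the next target and has length bounded in
terms of `b` alone. Hence every new column approximates `b` with conditional probability at least
some `p > 0` not depending on the column, and `N` consecutive failures have probability at most `(1
- p) ^ N` (`ae_exists_columnNear`). Countably many rational `b` and tolerances suffice for
universality. Properness comes from the first row, whose entries almost surely differ because `γ`
has no atoms. -/

/-! ### Isometric relations -/

/-- A relation between two metric spaces which preserves distances. -/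
def IsometricRel {X Y : Type*} [MetricSpace X] [MetricSpace Y] (G : Set (X × Y)) : Prop :=
  ∀ p ∈ G, ∀ q ∈ G, dist p.1 q.1 = dist p.2 q.2

section Relations

variable {X Y : Type*} [MetricSpace X] [MetricSpace Y] {G : Set (X × Y)}

theorem IsometricRel.isometricRel_closure (hG : IsometricRel G) : IsometricRel (closure G) := by
  have h : ∀ z ∈ closure (G ×ˢ G), dist z.1.1 z.2.1 = dist z.1.2 z.2.2 := by
    refine fun z hz => closure_minimal (t := {z : (X × Y) × (X × Y) |
      dist z.1.1 z.2.1 = dist z.1.2 z.2.2}) (fun z hz => hG _ hz.1 _ hz.2)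
      (isClosed_eq (by fun_prop) (by fun_prop)) hz
  intro p hp q hq
  exact h (p, q) (by rw [closure_prod_eq]; exact ⟨hp, hq⟩)

theorem IsometricRel.swap (hG : IsometricRel G) : IsometricRel (Prod.swap ⁻¹' G) :=
  fun _ hp _ hq => (hG _ hp _ hq).symm

/-- Along pairs of `G` whose first coordinates converge to `x`, the second coordinates are Cauchy
because distances agree. -/
theorem IsometricRel.exists_mem_closure [CompleteSpace Y] (hG : IsometricRel G)
    (hd : Dense (Prod.fst '' G)) (x : X) : ∃ y, (x, y) ∈ closure G := by
  obtain ⟨s, hs, hx⟩ := mem_closure_iff_seq_limit.1 (hd x)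
  choose g hg hgs using hs
  have hc : CauchySeq fun n => (g n).2 := by
    have h := hx.cauchySeq
    rw [Metric.cauchySeq_iff] at h ⊢
    simpa only [← hG _ (hg _) _ (hg _), hgs] using h
  obtain ⟨y, hy⟩ := cauchySeq_tendsto_of_complete hc
  refine ⟨y, mem_closure_of_tendsto (f := g) (b := atTop) ?_ (Eventually.of_forall hg)⟩
  rw [Prod.tendsto_iff]
  exact ⟨by simpa only [hgs] using hx, hy⟩

theorem IsometricRel.exists_isometry [CompleteSpace Y] (hG : IsometricRel G)
    (hd : Dense (Prod.fst '' G)) : ∃ f : X → Y, Isometry f := by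
  choose f hf using hG.exists_mem_closure hd
  exact ⟨f, Isometry.of_dist_eq fun x x' => (hG.isometricRel_closure _ (hf x) _ (hf x')).symm⟩

/-- The closure of `G` relates every point of either space to one of the other, and preservation of
distances makes it single-valued in both directions. -/
theorem IsometricRel.exists_isometryEquiv [CompleteSpace X] [CompleteSpace Y]
    (hG : IsometricRel G) (hd : Dense (Prod.fst '' G)) (hr : Dense (Prod.snd '' G)) :
    ∃ J : X ≃ᵢ Y, ∀ p ∈ G, J p.1 = p.2 := by
  have hc := hG.isometricRel_closure
  choose f hf using hG.exists_mem_closure hd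
  have hs : Dense (Prod.fst '' (Prod.swap ⁻¹' G : Set (Y × X))) := by
    convert hr using 1
    ext y
    simp
  have hg : ∀ y, ∃ x, (x, y) ∈ closure G := fun y => by
    obtain ⟨x, hx⟩ := hG.swap.exists_mem_closure hs y
    refine ⟨x, ?_⟩
    have h := (Homeomorph.prodComm Y X).preimage_closure G
    rw [Homeomorph.coe_prodComm] at h
    rw [← h] at hx
    exact hx
  choose g hg using hg
  refine ⟨⟨⟨f, g, fun x => ?_, fun y => ?_⟩, Isometry.of_dist_eq fun x x' =>
    (hc _ (hf x) _ (hf x')).symm⟩, fun p hp => ?_⟩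
  · exact dist_eq_zero.1 ((hc _ (hg (f x)) _ (hf x)).trans (dist_self _))
  · exact dist_eq_zero.1 ((hc _ (hf (g y)) _ (hg y)).symm.trans (dist_self _))
  · exact dist_eq_zero.1 ((hc _ (hf p.1) _ (subset_closure hp)).symm.trans (dist_self _))

end Relations

/-! ### The one-point extension property -/

/-- Every one-point metric extension of a finite subset is realized. -/
def OnePointExtension (U : Type*) [MetricSpace U] : Prop :=
  ∀ (n : ℕ) (x : Fin n → U), ∀ a ∈ admissible (fun i j => dist (x i) (x j)),
    ∃ u, ∀ i, dist (x i) u = a i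

section OnePoint

variable {X Y : Type*} [MetricSpace X] [MetricSpace Y]

theorem OnePointExtension.exists_insert (hY : OnePointExtension Y) {G : Set (X × Y)}
    (hf : G.Finite) (hG : IsometricRel G) (x : X) : ∃ y, IsometricRel (insert (x, y) G) := by
  have := hf.to_subtype
  obtain ⟨n, ⟨e⟩⟩ := Finite.exists_equiv_fin G
  obtain ⟨y, hy⟩ := hY n (fun i => (e.symm i).1.2) (fun i => dist (e.symm i).1.1 x) fun i j => by
    beta_reduce
    rw [← hG _ (e.symm i).2 _ (e.symm j).2]
    exact ⟨abs_dist_sub_le _ _ _, dist_triangle_right _ _ _⟩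
  have h : ∀ p ∈ G, dist p.2 y = dist p.1 x := fun p hp => by
    simpa using hy (e ⟨p, hp⟩)
  refine ⟨y, fun p hp q hq => ?_⟩
  rcases mem_insert_iff.1 hp with rfl | hp <;> rcases mem_insert_iff.1 hq with rfl | hq
  · simp
  · simpa [dist_comm] using (h q hq).symm
  · exact (h p hp).symm
  · exact hG p hp q hq

/-- Bookkeeping shared by the forth and the back-and-forth constructions: the requirements are met
one at a time, and being upward closed they survive in the union of the chain. -/
theorem exists_isometricRel_of_step (Q : ℕ → Set (X × Y) → Prop)
    (hQ : ∀ n G G', G ⊆ G' → Q n G → Q n G')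
    (hstep : ∀ n (G : Set (X × Y)), G.Finite → IsometricRel G →
      ∃ G', G'.Finite ∧ IsometricRel G' ∧ G ⊆ G' ∧ Q n G')
    {G₀ : Set (X × Y)} (hf : G₀.Finite) (h₀ : IsometricRel G₀) :
    ∃ G, IsometricRel G ∧ G₀ ⊆ G ∧ ∀ n, Q n G := by
  choose! F hF hI hsub hFQ using hstep
  let s : ℕ → Set (X × Y) := fun n => Nat.rec G₀ (fun k G => F k G) n
  have hs : ∀ n, (s n).Finite ∧ IsometricRel (s n) := fun n => by
    induction n with
    | zero => exact ⟨hf, h₀⟩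
    | succ k ih => exact ⟨hF k _ ih.1 ih.2, hI k _ ih.1 ih.2⟩
  have hm : Monotone s := monotone_nat_of_le_succ fun n => hsub n _ (hs n).1 (hs n).2
  refine ⟨⋃ n, s n, fun p hp q hq => ?_, subset_iUnion s 0, fun n => ?_⟩
  · obtain ⟨i, hi⟩ := mem_iUnion.1 hp
    obtain ⟨j, hj⟩ := mem_iUnion.1 hq
    exact (hs (max i j)).2 _ (hm (le_max_left _ _) hi) _ (hm (le_max_right _ _) hj)
  · exact hQ n _ _ (subset_iUnion s (n + 1)) (hFQ n _ (hs n).1 (hs n).2)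

theorem dense_image_of_denseSeq {α Z : Type*} [TopologicalSpace Z]
    [TopologicalSpace.SeparableSpace Z] [Nonempty Z] {f : α → Z} {G : Set α}
    (h : ∀ n, TopologicalSpace.denseSeq Z n ∈ f '' G) : Dense (f '' G) :=
  (TopologicalSpace.denseRange_denseSeq Z).mono (range_subset_iff.2 h)

theorem OnePointExtension.exists_isometry [TopologicalSpace.SeparableSpace X] [CompleteSpace Y]
    (hY : OnePointExtension Y) : ∃ f : X → Y, Isometry f := by
  rcases isEmpty_or_nonempty X with h | h
  · exact ⟨h.elim, fun x => h.elim x⟩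
  obtain ⟨G, hG, -, hQ⟩ := exists_isometricRel_of_step
    (fun n (G : Set (X × Y)) => TopologicalSpace.denseSeq X n ∈ Prod.fst '' G)
    (fun n G G' h => fun hq => image_mono h hq) (fun n G hf hG => by
      obtain ⟨y, hy⟩ := hY.exists_insert hf hG (TopologicalSpace.denseSeq X n)
      exact ⟨_, hf.insert _, hy, subset_insert _ _, _, mem_insert _ _, rfl⟩)
    finite_empty (fun p hp => hp.elim)
  exact hG.exists_isometry (dense_image_of_denseSeq hQ)

theorem OnePointExtension.nonempty (hY : OnePointExtension Y) : Nonempty Y :=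
  (hY 0 Fin.elim0 Fin.elim0 fun i => i.elim0).nonempty

theorem OnePointExtension.exists_isometryEquiv [TopologicalSpace.SeparableSpace X]
    [TopologicalSpace.SeparableSpace Y] [CompleteSpace X] [CompleteSpace Y]
    (hX : OnePointExtension X) (hY : OnePointExtension Y) {G₀ : Set (X × Y)} (hf : G₀.Finite)
    (h₀ : IsometricRel G₀) : ∃ J : X ≃ᵢ Y, ∀ p ∈ G₀, J p.1 = p.2 := by
  have := hX.nonempty
  have := hY.nonempty
  obtain ⟨G, hG, hsub, hQ⟩ := exists_isometricRel_of_step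
    (fun n (G : Set (X × Y)) => TopologicalSpace.denseSeq X n ∈ Prod.fst '' G ∧
      TopologicalSpace.denseSeq Y n ∈ Prod.snd '' G)
    (fun n G G' h hq => ⟨image_mono h hq.1, image_mono h hq.2⟩)
    (fun n G hf hG => by
      obtain ⟨y, hy⟩ := hY.exists_insert hf hG (TopologicalSpace.denseSeq X n)
      have hf' := hf.insert (TopologicalSpace.denseSeq X n, y)
      obtain ⟨x, hx⟩ := hX.exists_insert (hf'.preimage Prod.swap_injective.injOn) hy.swap
        (TopologicalSpace.denseSeq Y n)
      refine ⟨insert (x, TopologicalSpace.denseSeq Y n) (insert (TopologicalSpace.denseSeq X n, y)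
        G), hf'.insert _, fun p hp q hq => ?_,
        (subset_insert _ _).trans (subset_insert _ _), ?_, ?_⟩
      · exact (hx p.swap (by simpa [Prod.ext_iff, and_comm] using hp) q.swap
          (by simpa [Prod.ext_iff, and_comm] using hq)).symm
      · exact ⟨_, mem_insert_of_mem _ (mem_insert _ _), rfl⟩
      · exact ⟨_, mem_insert _ _, rfl⟩)
    hf h₀
  obtain ⟨J, hJ⟩ := hG.exists_isometryEquiv (dense_image_of_denseSeq fun n => (hQ n).1)
    (dense_image_of_denseSeq fun n => (hQ n).2)
  exact ⟨J, fun p hp => hJ p (hsub hp)⟩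

theorem OnePointExtension.isUrysohn [TopologicalSpace.SeparableSpace Y] [CompleteSpace Y]
    (hY : OnePointExtension Y) : IsUrysohn Y where
  complete := inferInstance
  separable := inferInstance
  universal _ := hY.exists_isometry
  homogeneous m a b hab := by
    obtain ⟨J, hJ⟩ := hY.exists_isometryEquiv hY (finite_range fun i => (a i, b i)) (by
      rintro _ ⟨i, rfl⟩ _ ⟨j, rfl⟩
      exact hab i j)
    exact ⟨J, fun i => hJ _ ⟨i, rfl⟩⟩

/-- The one-point extension of a finite subset of a metric space. -/
abbrev extensionPseudoMetric {n : ℕ} (x : Fin n → Y) (a : Fin n → ℝ)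
    (ha : a ∈ admissible fun i j => dist (x i) (x j)) : PseudoMetricSpace (Option (Fin n)) where
  dist
    | none, none => 0
    | none, some i => a i
    | some i, none => a i
    | some i, some j => dist (x i) (x j)
  dist_self := by rintro (_ | i) <;> simp
  dist_comm := by rintro (_ | i) (_ | j) <;> simp [dist_comm]
  dist_triangle := by
    have h := fun i j => abs_le.1 (ha i j).1
    have h0 : ∀ i, 0 ≤ a i := fun i => by have := (ha i i).2; simp at this; linarith
    rintro (_ | i) (_ | j) (_ | k)
    · simp
    · simp
    · simpa using h0 j
    · have := h k j
      have := dist_comm (x k) (x j)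
      simp only
      linarith
    · simp
    · simpa using (ha i k).2
    · simp only
      linarith [h i j]
    · exact dist_triangle _ _ _

/-- The abstract extension is finite, hence Polish, and embeds by universality; homogeneity then
moves the image of the old points back onto `x`. -/
theorem IsUrysohn.onePointExtension (hY : IsUrysohn Y) : OnePointExtension Y := by
  intro n x a ha
  let := extensionPseudoMetric x a ha
  -- The quotient is needed because `x` may repeat points and `a` may vanish.
  have : Finite (SeparationQuotient (Option (Fin n))) := Quotient.finite _
  obtain ⟨f, hf⟩ := hY.universal (SeparationQuotient (Option (Fin n)))
  obtain ⟨J, hJ⟩ := hY.homogeneous n (fun i => f (SeparationQuotient.mk (some i))) x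
    fun i j => by rw [hf.dist_eq, SeparationQuotient.dist_mk]; rfl
  refine ⟨J (f (SeparationQuotient.mk none)), fun i => ?_⟩
  rw [← hJ i, J.isometry.dist_eq, hf.dist_eq, SeparationQuotient.dist_mk]
  rfl

theorem IsUrysohn.nonempty_isometryEquiv (hX : IsUrysohn X) (hY : IsUrysohn Y) :
    Nonempty (X ≃ᵢ Y) := by
  have := hX.complete
  have := hX.separable
  have := hY.complete
  have := hY.separable
  obtain ⟨J, -⟩ := hX.onePointExtension.exists_isometryEquiv hY.onePointExtension finite_empty
    (fun p hp => hp.elim)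
  exact ⟨J⟩

/-! ### From approximate to exact extensions -/

/-- Every one-point metric extension of a finite subset is realized approximately. -/
def ApproxExtension (U : Type*) [MetricSpace U] : Prop :=
  ∀ ε : ℝ, 0 < ε → ∀ (n : ℕ) (x : Fin n → U), ∀ a ∈ admissible (fun i j => dist (x i) (x j)),
    ∃ u, ∀ i, |dist (x i) u - a i| < ε

/-- Adjoin `u` to the given points and prescribe as distance to it its own error `s`. The enlarged
vector is still admissible, so a better approximation exists within `s + δ` of `u`. -/
theorem ApproxExtension.exists_refine (hY : ApproxExtension Y) {n : ℕ} {x : Fin n → Y}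
    {a : Fin n → ℝ} (ha : a ∈ admissible fun i j => dist (x i) (x j)) {ε δ : ℝ} (hδ : 0 < δ)
    {u : Y} (hu : dist (fun i => dist (x i) u) a ≤ ε) :
    ∃ v, dist (fun i => dist (x i) v) a ≤ δ ∧ dist u v ≤ ε + δ := by
  set s := dist (fun i => dist (x i) u) a with hs
  have h0 : ∀ i, 0 ≤ a i := fun i => by have := (ha i i).2; simp at this; linarith
  have hle : ∀ i, |dist (x i) u - a i| ≤ s := fun i =>
    dist_le_pi_dist (fun i => dist (x i) u) a i
  have hge : ∀ i, s ≤ a i + dist (x i) u := fun i => by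
    rw [hs, dist_pi_le_iff (add_nonneg (h0 i) dist_nonneg)]
    intro j
    have h1 := abs_le.1 (ha j i).1
    have h2 := (ha j i).2
    have h3 := dist_triangle (x j) (x i) u
    have h4 := dist_triangle_right (x j) (x i) u
    rw [Real.dist_eq, abs_le]
    constructor <;> linarith
  obtain ⟨v, hv⟩ := hY δ hδ (n + 1) (Fin.snoc x u) (Fin.snoc a s) (by
    intro i j
    refine Fin.lastCases ?_ (fun i => ?_) i <;> refine Fin.lastCases ?_ (fun j => ?_) j
    · simp [hs]
    · have h1 := abs_le.1 (hle j)
      have h2 := hge j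
      simp only [Fin.snoc_last, Fin.snoc_castSucc, abs_le, dist_comm u]
      refine ⟨⟨?_, ?_⟩, ?_⟩ <;> linarith
    · have h1 := abs_le.1 (hle i)
      have h2 := hge i
      simp only [Fin.snoc_last, Fin.snoc_castSucc, abs_le]
      refine ⟨⟨?_, ?_⟩, ?_⟩ <;> linarith
    · simpa using ha i j)
  refine ⟨v, ?_, ?_⟩
  · rw [dist_pi_le_iff hδ.le]
    intro i
    simpa [Real.dist_eq] using (hv i.castSucc).le
  · have := abs_lt.1 (hv (Fin.last n))
    simp only [Fin.snoc_last] at this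
    linarith

theorem ApproxExtension.onePointExtension [CompleteSpace Y] (hY : ApproxExtension Y) :
    OnePointExtension Y := by
  intro n x a ha
  have hp : ∀ k : ℕ, (0 : ℝ) < 1 / 2 / 2 ^ k := fun k => by positivity
  obtain ⟨u₀, hu₀⟩ := hY _ (hp 0) n x a ha
  choose! F hF hF' using fun (k : ℕ) (u : Y)
    (hu : dist (fun i => dist (x i) u) a ≤ 1 / 2 / 2 ^ k) =>
    hY.exists_refine ha (hp (k + 1)) hu
  let s : ℕ → Y := fun k => Nat.rec u₀ (fun k u => F k u) k
  have hs : ∀ k, dist (fun i => dist (x i) (s k)) a ≤ 1 / 2 / 2 ^ k := fun k => by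
    induction k with
    | zero => exact (dist_pi_le_iff (hp 0).le).2 fun i => (hu₀ i).le
    | succ k ih => exact hF k _ ih
  -- Consecutive errors add up to 3/2 of the first one; the bound is rounded up to twice it, in the
  -- form `cauchySeq_of_le_geometric_two` expects.
  have hd : ∀ k, dist (s k) (s (k + 1)) ≤ 2 / 2 / 2 ^ k := fun k => by
    refine (hF' k _ (hs k)).trans ?_
    rw [pow_succ, ← div_div]
    linarith [hp k, show (2 / 2 / 2 ^ k : ℝ) = 2 * (1 / 2 / 2 ^ k) by ring]
  obtain ⟨u, hu⟩ := cauchySeq_tendsto_of_complete (cauchySeq_of_le_geometric_two hd)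
  refine ⟨u, fun i => ?_⟩
  have h1 : Tendsto (fun k => dist (dist (x i) (s k)) (a i)) atTop
      (𝓝 (dist (dist (x i) u) (a i))) :=
    (tendsto_const_nhds.dist hu).dist tendsto_const_nhds
  have h2 : Tendsto (fun k : ℕ => (1 / 2 / 2 ^ k : ℝ)) atTop (𝓝 0) := by
    simpa [div_eq_mul_inv] using (tendsto_pow_atTop_nhds_zero_of_lt_one (r := (2⁻¹ : ℝ))
      (by norm_num) (by norm_num)).const_mul 2⁻¹
  have h3 : Tendsto (fun k => dist (dist (x i) (s k)) (a i)) atTop (𝓝 0) :=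
    squeeze_zero (fun _ => dist_nonneg)
      (fun k => (dist_le_pi_dist (fun i => dist (x i) (s k)) a i).trans (hs k)) h2
  exact dist_eq_zero.1 (tendsto_nhds_unique h1 h3)

/-- A vector admissible for a finite subset extends to a function whose restriction to every
finite subset is admissible. -/
theorem exists_katetov {n : ℕ} (x : Fin (n + 1) → Y) {a : Fin (n + 1) → ℝ}
    (ha : a ∈ admissible fun i j => dist (x i) (x j)) :
    ∃ f : Y → ℝ, (∀ i, f (x i) = a i) ∧ ∀ y z, |f y - f z| ≤ dist y z ∧ dist y z ≤ f y + f z := by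
  -- The extension is `y ↦ min_i (a i + dist (x i) y)`; the minimum needs a nonempty index set.
  have hex : ∀ y, ∃ i, ∀ j, a i + dist (x i) y ≤ a j + dist (x j) y := fun y =>
    Finite.exists_min fun i => a i + dist (x i) y
  choose g hg using hex
  have hle : ∀ y z, a (g y) + dist (x (g y)) y ≤ a (g z) + dist (x (g z)) z + dist y z :=
    fun y z => by linarith [hg y (g z), dist_triangle_right (x (g z)) y z]
  refine ⟨fun y => a (g y) + dist (x (g y)) y, fun i => ?_, fun y z => ⟨?_, ?_⟩⟩
  · refine le_antisymm (by simpa using hg (x i) i) ?_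
    have := abs_le.1 (ha i (g (x i))).1
    have := dist_comm (x i) (x (g (x i)))
    simp only at *
    linarith
  · rw [abs_le]
    have := hle y z
    have := hle z y
    have := dist_comm y z
    constructor <;> linarith
  · have := (ha (g y) (g z)).2
    have := dist_triangle y (x (g y)) z
    have := dist_triangle (x (g y)) (x (g z)) z
    have := dist_comm (x (g y)) y
    simp only at *
    linarith

end OnePoint

/-! ### The completion of the integers with respect to a universal matrix -/

/-- The point of the completion given by an integer. -/
def completedPoint (r : distCone) (i : ℕ) : Completed r :=
  UniformSpace.Completion.coe' (α := Points r) i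

theorem dist_completedPoint (r : distCone) (i j : ℕ) :
    dist (completedPoint r i) (completedPoint r j) = r.1 i j :=
  UniformSpace.Completion.dist_eq _ _

theorem denseRange_completedPoint (r : distCone) : DenseRange (completedPoint r) :=
  UniformSpace.Completion.denseRange_coe (α := Points r)

/-- The points `x i` need not be integers, so `a` is extended to the whole completion and
universality is applied to the values of the extension at integers close to the `x i`. Each of the
three errors is at most `ε / 3`. -/
theorem IsUniversal.approxExtension {r : distCone} (hr : IsUniversal r) :
    ApproxExtension (Completed r) := by
  intro ε hε n x a ha
  rcases n with _ | n
  · exact ⟨completedPoint r 0, fun i => i.elim0⟩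
  obtain ⟨f, hfx, hf⟩ := exists_katetov x ha
  choose p hp using fun i =>
    (denseRange_completedPoint r).exists_dist_lt (x i) (show 0 < ε / 3 by positivity)
  obtain ⟨N, hN⟩ : ∃ N, ∀ i, p i < N :=
    ⟨(Finset.univ.sup p) + 1, fun i => Nat.lt_succ_of_le (Finset.le_sup (Finset.mem_univ i))⟩
  obtain ⟨m, hm⟩ := hr (ε / 3) (by positivity) N (fun i => f (completedPoint r i)) fun i j => by
    simpa only [dist_completedPoint, corner] using hf (completedPoint r i) (completedPoint r j)
  refine ⟨completedPoint r m, fun i => ?_⟩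
  have h1 := hm ⟨p i, hN i⟩
  have h2 := (hf (x i) (completedPoint r (p i))).1
  have h3 := abs_dist_sub_le (x i) (completedPoint r (p i)) (completedPoint r m)
  rw [dist_completedPoint] at h3
  rw [hfx] at h2
  have := hp i
  rw [abs_lt] at *
  rw [abs_le] at h2 h3
  constructor <;> linarith

theorem IsUniversal.isUrysohn {r : distCone} (hr : IsUniversal r) : IsUrysohn (Completed r) := by
  have : Countable (Points r) := inferInstanceAs (Countable ℕ)
  exact hr.approxExtension.onePointExtension.isUrysohn

/-! ### The order of the entries -/

theorem entryIndex_zero_succ (j : ℕ) : entryIndex 0 (j + 1) = entryIndex 0 j + j := by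
  simp [entryIndex, Nat.choose_succ_succ' j 1, add_comm]

theorem entryIndex_eq (i j : ℕ) : entryIndex i j = entryIndex 0 j + i := by simp [entryIndex]

theorem entryIndex_zero_mono : Monotone (entryIndex 0) :=
  monotone_nat_of_le_succ fun j => by rw [entryIndex_zero_succ]; omega

theorem entryIndex_lt_entryIndex_zero {i j m : ℕ} (hij : i < j) (hjm : j < m) :
    entryIndex i j < entryIndex 0 m := by
  have h := entryIndex_zero_mono (Nat.succ_le_of_lt hjm)
  rw [Nat.succ_eq_add_one, entryIndex_zero_succ] at h
  rw [entryIndex_eq]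
  omega

theorem entryIndex_zero_pos {m : ℕ} (hm : 2 ≤ m) : 0 < entryIndex 0 m :=
  (Nat.zero_le _).trans_lt (entryIndex_lt_entryIndex_zero Nat.zero_lt_one hm)

theorem entryAt_spec (t : ℕ) :
    (entryAt t).1 < (entryAt t).2 ∧ entryIndex (entryAt t).1 (entryAt t).2 = t := by
  induction t with
  | zero => simp [entryAt, entryIndex]
  | succ t ih =>
    obtain ⟨h1, h2⟩ := ih
    rw [entryIndex_eq] at h2
    rw [entryAt]
    split_ifs with h
    · refine ⟨h, ?_⟩
      rw [entryIndex_eq]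
      simp only
      omega
    · refine ⟨Nat.succ_pos _, ?_⟩
      rw [entryIndex_zero_succ]
      omega

theorem entryAt_entryIndex {i j : ℕ} (hij : i < j) : entryAt (entryIndex i j) = (i, j) := by
  obtain ⟨h1, h2⟩ := entryAt_spec (entryIndex i j)
  have hj : (entryAt (entryIndex i j)).2 = j := by
    rw [entryIndex_eq] at h2
    have h3 := entryIndex_eq i j
    rcases lt_trichotomy (entryAt (entryIndex i j)).2 j with h | h | h
    · have := entryIndex_lt_entryIndex_zero h1 h
      rw [entryIndex_eq] at this
      omega
    · exact h
    · have := entryIndex_lt_entryIndex_zero hij h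
      omega
  refine Prod.ext ?_ hj
  rw [hj, entryIndex_eq] at h2
  have h3 := entryIndex_eq i j
  simp only
  omega

/-! ### Matrices of entries -/

theorem toMatrix_self (x : ℕ → ℝ) (i : ℕ) : toMatrix x i i = 0 := by simp [toMatrix]

theorem toMatrix_of_lt (x : ℕ → ℝ) {i j : ℕ} (h : i < j) : toMatrix x i j = x (entryIndex i j) := by
  simp [toMatrix, h]

theorem toMatrix_comm (x : ℕ → ℝ) (i j : ℕ) : toMatrix x i j = toMatrix x j i := by
  rcases lt_trichotomy i j with h | rfl | h
  · simp [toMatrix, h, h.not_gt]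
  · rfl
  · simp [toMatrix, h, h.not_gt]

theorem fragment_frestrictLe (x : ℕ → ℝ) {t i j : ℕ} (hij : i < j) (ht : entryIndex i j ≤ t) :
    fragment t (Preorder.frestrictLe t x) i j = toMatrix x i j := by
  rw [fragment, toMatrix_of_lt _ hij, toMatrix_of_lt _ hij, dif_pos (Finset.mem_Iic.2 ht)]
  rfl

theorem lower_congr {k j : ℕ} {q r : ℕ → ℕ → ℝ} (h1 : ∀ i ≤ k, q i (k + 1) = r i (k + 1))
    (h2 : ∀ i ≤ k, q i j = r i j) : lower k j q = lower k j r :=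
  Finset.sup'_congr _ rfl fun i hi => by
    have := Finset.mem_range_succ_iff.1 hi
    rw [h1 i this, h2 i this]

theorem upper_congr {k j : ℕ} {q r : ℕ → ℕ → ℝ} (h1 : ∀ i ≤ k, q i (k + 1) = r i (k + 1))
    (h2 : ∀ i ≤ k, q i j = r i j) : upper k j q = upper k j r :=
  Finset.inf'_congr _ rfl fun i hi => by
    have := Finset.mem_range_succ_iff.1 hi
    rw [h1 i this, h2 i this]

/-- The segment for the entry `(k + 1, j)` depends only on entries already chosen, so the zeros
filling up a fragment are never read. -/
theorem fragment_row_eq (x : ℕ → ℝ) {t k j : ℕ} (hkj : k + 1 < j)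
    (ht : entryIndex (k + 1) j = t + 1) :
    (∀ i ≤ k, fragment t (Preorder.frestrictLe t x) i (k + 1) = toMatrix x i (k + 1)) ∧
    ∀ i ≤ k, fragment t (Preorder.frestrictLe t x) i j = toMatrix x i j := by
  rw [entryIndex_eq] at ht
  refine ⟨fun i hi => fragment_frestrictLe x (by omega) ?_,
    fun i hi => fragment_frestrictLe x (by omega) ?_⟩
  · have := entryIndex_lt_entryIndex_zero (Nat.lt_add_one_of_le hi) hkj
    omega
  · rw [entryIndex_eq]
    omega

theorem lower_fragment (x : ℕ → ℝ) {t k j : ℕ} (hkj : k + 1 < j)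
    (ht : entryIndex (k + 1) j = t + 1) :
    lower k j (fragment t (Preorder.frestrictLe t x)) = lower k j (toMatrix x) :=
  lower_congr (fragment_row_eq x hkj ht).1 (fragment_row_eq x hkj ht).2

theorem upper_fragment (x : ℕ → ℝ) {t k j : ℕ} (hkj : k + 1 < j)
    (ht : entryIndex (k + 1) j = t + 1) :
    upper k j (fragment t (Preorder.frestrictLe t x)) = upper k j (toMatrix x) :=
  upper_congr (fragment_row_eq x hkj ht).1 (fragment_row_eq x hkj ht).2

theorem stepKernel_frestrictLe (γ : Measure ℝ≥0) (x : ℕ → ℝ) {t i j : ℕ} (hij : i < j)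
    (ht : entryIndex i j = t + 1) :
    stepKernel γ t (Preorder.frestrictLe t x) = entryKernel γ i j (toMatrix x) := by
  rw [stepKernel, Kernel.comap_apply, ← ht, entryAt_entryIndex hij]
  rcases i with _ | k
  · rfl
  · simp only [entryKernel, Kernel.comap_apply]
    rw [lower_fragment x hij ht, upper_fragment x hij ht]

/-! ### The triangle inequality -/

theorem lower_le {k n : ℕ} {r : ℕ → ℕ → ℝ} {c : ℝ} :
    lower k n r ≤ c ↔ ∀ i ≤ k, |r i (k + 1) - r i n| ≤ c := by
  simp [lower, Finset.sup'_le_iff]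

theorem le_upper {k n : ℕ} {r : ℕ → ℕ → ℝ} {c : ℝ} :
    c ≤ upper k n r ↔ ∀ i ≤ k, c ≤ r i (k + 1) + r i n := by
  simp [upper, Finset.le_inf'_iff]

/-- Compare the bounds from rows `i` and `j` through the edge `i j`. Only triangles with at most one
of the vertices `k + 1`, `n` occur, so the entry about to be chosen is not involved. -/
theorem lower_le_upper {k n : ℕ} {r : ℕ → ℕ → ℝ}
    (h : ∀ l, l = k + 1 ∨ l = n → ∀ i ≤ k, ∀ j ≤ k, r i l ≤ r i j + r j l ∧ r i j ≤ r i l + r j l) :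
    lower k n r ≤ upper k n r := by
  rw [lower_le]
  intro i hi
  rw [le_upper]
  intro j hj
  obtain ⟨h1, h2⟩ := h (k + 1) (Or.inl rfl) i hi j hj
  obtain ⟨h3, h4⟩ := h n (Or.inr rfl) i hi j hj
  rw [abs_le]
  constructor <;> linarith

/-- Induction on columns and, within a column, on rows: the triangle inequalities obtained so far
make the next segment nonempty, and membership in it gives the next ones. -/
theorem mem_distCone_of_mem_segment {r : ℕ → ℕ → ℝ} (hself : ∀ i, r i i = 0)
    (hcomm : ∀ i j, r i j = r j i) (h0 : ∀ j, 0 ≤ r 0 j)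
    (hseg : ∀ k j, k + 1 < j → lower k j r ≤ upper k j r →
      lower k j r ≤ r (k + 1) j ∧ r (k + 1) j ≤ upper k j r) : r ∈ distCone := by
  have key : ∀ n, ∀ i < n, ∀ j < n, ∀ k < n, r i j ≤ r i k + r k j := by
    intro n
    induction n with
    | zero => simp
    | succ n ih =>
      have col : ∀ k < n, ∀ i ≤ k, ∀ j ≤ k, r i n ≤ r i j + r j n ∧ r i j ≤ r i n + r j n := by
        intro k
        induction k with
        | zero =>
          intro _ i hi j hj
          obtain rfl := Nat.le_zero.1 hi
          obtain rfl := Nat.le_zero.1 hj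
          rw [hself]
          constructor <;> linarith [h0 n]
        | succ k ihk =>
          intro hk
          have hprev := ihk (by omega)
          have hle : lower k n r ≤ upper k n r := by
            refine lower_le_upper fun l hl i hi j hj => ?_
            rcases hl with rfl | rfl
            · refine ⟨ih _ (by omega) _ (by omega) _ (by omega), ?_⟩
              rw [hcomm j]
              exact ih _ (by omega) _ (by omega) _ (by omega)
            · exact hprev i hi j hj
          obtain ⟨hl, hu⟩ := hseg k n hk hle
          rw [lower_le] at hl
          rw [le_upper] at hu
          have h3 : ∀ i ≤ k, r i n ≤ r i (k + 1) + r (k + 1) n ∧ r i (k + 1) ≤ r i n + r (k + 1) n ∧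
              r (k + 1) n ≤ r i (k + 1) + r i n := fun i hi => by
            have h1 := abs_le.1 (hl i hi)
            refine ⟨?_, ?_, hu i hi⟩ <;> linarith
          intro i hi j hj
          rcases Nat.le_succ_iff.1 hi with hi | rfl <;> rcases Nat.le_succ_iff.1 hj with hj | rfl
          · exact hprev i hi j hj
          · exact ⟨(h3 i hi).1, (h3 i hi).2.1⟩
          · rw [Nat.succ_eq_add_one, hcomm (k + 1) j]
            refine ⟨(h3 j hj).2.2, ?_⟩
            linarith [(h3 j hj).2.1]
          -- Nonnegativity of the new entry comes from adding two triangle inequalities through row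
          -- `0`.
          · obtain ⟨h4, h5, h6⟩ := h3 0 (Nat.zero_le _)
            rw [Nat.succ_eq_add_one, hself]
            constructor <;> linarith
      intro i hi j hj k hk
      rcases Nat.lt_succ_iff_lt_or_eq.1 hi with hi | rfl <;>
        rcases Nat.lt_succ_iff_lt_or_eq.1 hj with hj | rfl <;>
        rcases Nat.lt_succ_iff_lt_or_eq.1 hk with hk | rfl
      · exact ih i hi j hj k hk
      · rw [hcomm k j]
        exact (col (max i j) (by omega) i (by omega) j (by omega)).2
      · exact (col (max i k) (by omega) i (by omega) k (by omega)).1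
      · rw [hself]; linarith
      · rw [hcomm _ j, hcomm _ k, hcomm k j, add_comm]
        exact (col (max j k) (by omega) j (by omega) k (by omega)).1
      · rw [hself]; linarith
      · have := (col k hk k le_rfl k le_rfl).2
        rw [hself] at this ⊢
        rw [hcomm _ k]
        exact this
      · rw [hself]; linarith
  have tri : ∀ i j k, r i j ≤ r i k + r k j := fun i j k =>
    key (i + j + k + 1) i (by omega) j (by omega) k (by omega)
  refine ⟨hself, fun i j => ?_, hcomm, tri⟩
  have := tri i i j
  rw [hself, hcomm j i] at this
  linarith

theorem measurableSet_distCone : MeasurableSet distCone := by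
  have : distCone = {r : ℕ → ℕ → ℝ | (∀ i, r i i = 0) ∧ (∀ i j, 0 ≤ r i j) ∧
    (∀ i j, r i j = r j i) ∧ ∀ i j k, r i j ≤ r i k + r k j} := rfl
  rw [this]
  measurability

/-! ### Approximately admissible vectors -/

/-- The matrices for which the first `n` entries of `b` are admissible up to `2 * η`. -/
def nearAdmissible (n : ℕ) (b : ℕ → ℝ) (η : ℝ) : Set (ℕ → ℕ → ℝ) :=
  {q | ∀ i < n, ∀ j < n, |b i - b j| ≤ q i j + 2 * η ∧ q i j ≤ b i + b j + 2 * η}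

/-- The tolerance with which the `i`-th entry of a column is required to approximate a vector. -/
def tolerance (η : ℝ) (i : ℕ) : ℝ := (3 * i + 1) * η

/-- The first `n` entries of the column `m` approximate `b`. -/
def columnNear (n m : ℕ) (b : ℕ → ℝ) (η : ℝ) : Set (ℕ → ℕ → ℝ) :=
  {q | ∀ i < n, |q i m - b i| ≤ tolerance η i}

/-- The witness is the projection of `b (k + 1)` to the segment. -/
theorem exists_mem_segment_near {n m k : ℕ} {b : ℕ → ℝ} {η : ℝ} {r : ℕ → ℕ → ℝ} (hη : 0 < η)
    (hr : r ∈ distCone) (hb : r ∈ nearAdmissible n b η) (hk : k + 1 < n)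
    (hm : r ∈ columnNear (k + 1) m b η) :
    ∃ c ∈ Icc (lower k m r) (upper k m r), |c - b (k + 1)| ≤ tolerance η (k + 1) - η := by
  obtain ⟨-, -, hcomm, htri⟩ := hr
  -- Tolerances grow by `3 * η` per row: `2 * η` absorbs the defect of admissibility, and `η` leaves
  -- room for a ball around the witness.
  have htol : ∀ i ≤ k, tolerance η i + 2 * η ≤ tolerance η (k + 1) - η := fun i hi => by
    have : (i : ℝ) ≤ k := by exact_mod_cast hi
    simp only [tolerance]
    push_cast
    nlinarith
  have hle : lower k m r ≤ upper k m r := lower_le_upper fun l _ i _ j _ =>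
    ⟨htri _ _ _, by rw [hcomm j l]; exact htri _ _ _⟩
  have hl : lower k m r ≤ b (k + 1) + (tolerance η (k + 1) - η) := by
    rw [lower_le]
    intro i hi
    have h1 := abs_le.1 (hm i (Nat.lt_succ_of_le hi))
    obtain ⟨h2, h3⟩ := hb i (by omega) (k + 1) hk
    have h2 := abs_le.1 h2
    have h4 := htol i hi
    rw [abs_le]
    constructor <;> linarith
  have hu : b (k + 1) - (tolerance η (k + 1) - η) ≤ upper k m r := by
    rw [le_upper]
    intro i hi
    have h1 := abs_le.1 (hm i (Nat.lt_succ_of_le hi))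
    obtain ⟨h2, h3⟩ := hb i (by omega) (k + 1) hk
    have h2 := abs_le.1 h2
    have h4 := htol i hi
    linarith
  have hpos : 0 ≤ tolerance η (k + 1) - η := by
    have : 0 ≤ tolerance η 0 := by simp [tolerance, hη.le]
    linarith [htol 0 (Nat.zero_le _)]
  refine ⟨max (lower k m r) (min (b (k + 1)) (upper k m r)),
    ⟨le_max_left _ _, max_le hle (min_le_right _ _)⟩, ?_⟩
  rw [abs_le]
  constructor
  · have : b (k + 1) - (tolerance η (k + 1) - η) ≤ min (b (k + 1)) (upper k m r) :=
      le_min (by linarith) hu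
    linarith [le_max_right (lower k m r) (min (b (k + 1)) (upper k m r))]
  · have : max (lower k m r) (min (b (k + 1)) (upper k m r)) ≤
        b (k + 1) + (tolerance η (k + 1) - η) :=
      max_le hl ((min_le_left _ _).trans (by linarith))
    linarith

/-- Row `0` alone bounds the length, uniformly in the column `m`; this is why `p` can be chosen
independent of `m`. -/
theorem upper_sub_lower_le {n m k : ℕ} {b : ℕ → ℝ} {η : ℝ} {r : ℕ → ℕ → ℝ}
    (hb : r ∈ nearAdmissible n b η) (hk : k + 1 < n) (hm : r ∈ columnNear (k + 1) m b η) :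
    upper k m r - lower k m r ≤ 2 * b 0 + b (k + 1) + 3 * η := by
  have h1 := le_upper.1 (le_refl (upper k m r)) 0 (Nat.zero_le _)
  have h2 := (abs_nonneg _).trans (lower_le.1 (le_refl (lower k m r)) 0 (Nat.zero_le _))
  have h3 := (hb 0 (by omega) (k + 1) hk).2
  have h4 := abs_le.1 (hm 0 (Nat.succ_pos _))
  simp only [tolerance] at h4
  push_cast at h4
  linarith

theorem isUniversal_of_nearAdmissible {r : distCone}
    (h : ∀ (n : ℕ) (b : Fin n → ℚ≥0) (N : ℕ),
      r.1 ∈ nearAdmissible n (fun i => if hi : i < n then ((b ⟨i, hi⟩ : ℚ≥0) : ℝ) else 0)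
        (1 / (N + 1)) → ∃ m, r.1 ∈ columnNear n m
        (fun i => if hi : i < n then ((b ⟨i, hi⟩ : ℚ≥0) : ℝ) else 0) (1 / (N + 1))) :
    IsUniversal r := by
  intro ε hε n a ha
  -- Tolerances stay below `(3 * n + 1) * η`, and one more `η` pays for rounding `a` to rationals.
  have hn : (0 : ℝ) < 3 * n + 2 := by positivity
  obtain ⟨N, hN⟩ := exists_nat_one_div_lt (div_pos hε hn)
  rw [lt_div_iff₀ hn] at hN
  have hη : (0 : ℝ) < 1 / (N + 1) := by positivity
  set η : ℝ := 1 / (N + 1)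
  have h0 : ∀ i, 0 ≤ a i := fun i => by
    have := (ha i i).2
    rw [corner, r.2.1] at this
    linarith
  have hq : ∀ i, ∃ q : ℚ≥0, |(q : ℝ) - a i| ≤ η := fun i => by
    obtain ⟨q, h1, h2⟩ := exists_rat_btwn (lt_add_of_pos_right (a i) hη)
    have hq0 : (0 : ℚ) ≤ q := by exact_mod_cast (h0 i).trans h1.le
    lift q to ℚ≥0 using hq0
    rw [Rat.cast_nnratCast] at h1 h2
    refine ⟨q, ?_⟩
    rw [abs_le]
    constructor <;> linarith
  choose b hb using hq
  obtain ⟨m, hm⟩ := h n b N (by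
    intro i hi j hj
    have h1 := ha ⟨i, hi⟩ ⟨j, hj⟩
    have h2 := abs_le.1 (hb ⟨i, hi⟩)
    have h3 := abs_le.1 (hb ⟨j, hj⟩)
    have h4 := abs_le.1 h1.1
    have h5 := h1.2
    simp only [corner] at h4 h5
    simp only [dif_pos hi, dif_pos hj, abs_le]
    refine ⟨⟨?_, ?_⟩, ?_⟩ <;> linarith)
  refine ⟨m, fun i => ?_⟩
  have h1 := hm i i.2
  simp only [dif_pos i.2, Fin.eta, tolerance] at h1
  have h2 := abs_le.1 h1
  have h3 := abs_le.1 (hb i)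
  have h4 : (i : ℝ) ≤ n := by exact_mod_cast i.2.le
  have h5 : (3 * (i : ℝ) + 1) * η ≤ (3 * n + 1) * η := by gcongr
  rw [abs_lt]
  constructor <;> linarith

/-! ### Uniform distributions -/

theorem ae_unif_mem_Icc (a b : ℝ) : ∀ᵐ y ∂unif a b, a ≤ b → a ≤ y ∧ y ≤ b := by
  unfold unif
  split_ifs with h
  · refine Measure.ae_smul_measure ?_ _
    filter_upwards [ae_restrict_mem measurableSet_Icc] with y hy _ using hy
  · rw [ae_dirac_eq]
    exact fun hab => ⟨le_rfl, hab⟩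

/-- The ball meets the segment in length at least `min η (b - a)`. The form `η / (η + M)` also
covers short and degenerate segments. -/
theorem le_unif_closedBall {a b c η M : ℝ} (hc : c ∈ Icc a b) (hη : 0 < η) (hM : b - a ≤ M) :
    ENNReal.ofReal (η / (η + M)) ≤ unif a b (Metric.closedBall c η) := by
  obtain ⟨hac, hcb⟩ := hc
  have hM0 : 0 ≤ M := by linarith
  unfold unif
  split_ifs with h
  · have hd : 0 < b - a := by linarith
    rw [Measure.smul_apply, smul_eq_mul, Measure.restrict_apply measurableSet_closedBall,
      Real.closedBall_eq_Icc, Icc_inter_Icc, Real.volume_Icc, Real.volume_Icc,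
      ← ENNReal.ofReal_inv_of_pos hd, ← ENNReal.ofReal_mul (inv_nonneg.2 hd.le)]
    refine ENNReal.ofReal_le_ofReal ?_
    have h1 : min η (b - a) ≤ min (c + η) b - max (c - η) a := by
      rcases max_cases (c - η) a with h | h <;> rcases min_cases (c + η) b with h' | h' <;>
        rcases min_cases η (b - a) with h'' | h'' <;> linarith
    calc η / (η + M) ≤ (b - a)⁻¹ * min η (b - a) := by
          rw [div_le_iff₀ (by positivity), mul_assoc, le_inv_mul_iff₀ hd]
          rcases min_cases η (b - a) with h | h <;> rw [h.1] <;> nlinarith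
      _ ≤ _ := by gcongr
  · obtain rfl : c = a := by linarith
    rw [Measure.dirac_apply' _ measurableSet_closedBall,
      indicator_of_mem (Metric.mem_closedBall_self hη.le)]
    simp only [Pi.one_apply]
    rw [← ENNReal.ofReal_one]
    refine ENNReal.ofReal_le_ofReal ?_
    rw [div_le_one (by positivity)]
    linarith

/-! ### The law of the entries -/

section Law

variable (γ : Measure ℝ≥0)

theorem nullSingletonClass_map_coe [NullSingletonClass γ] :
    NullSingletonClass (γ.map ((↑) : ℝ≥0 → ℝ)) := by
  refine ⟨fun x => ?_⟩
  rw [Measure.map_apply (by fun_prop) (measurableSet_singleton x)]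
  exact (subsingleton_singleton.preimage NNReal.coe_injective).measure_zero γ

theorem ae_map_coe_nonneg : ∀ᵐ y ∂γ.map ((↑) : ℝ≥0 → ℝ), 0 ≤ y := by
  rw [ae_map_iff (by fun_prop) measurableSet_Ici]
  exact Eventually.of_forall fun y => y.2

variable [IsProbabilityMeasure γ]

instance isProbabilityMeasure_map_coe : IsProbabilityMeasure (γ.map ((↑) : ℝ≥0 → ℝ)) :=
  Measure.isProbabilityMeasure_map (by fun_prop)

instance : IsProbabilityMeasure (entryLaw γ) := by
  unfold entryLaw; infer_instance

theorem map_compProd_stepKernel (t : ℕ) :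
    (entryLaw γ).map (Preorder.frestrictLe t) ⊗ₘ stepKernel γ t =
      (entryLaw γ).map fun x => (Preorder.frestrictLe t x, x (t + 1)) :=
  Kernel.map_frestrictLe_trajMeasure_compProd_eq_map_trajMeasure

theorem map_eval_zero_entryLaw :
    (entryLaw γ).map (fun x => x 0) = γ.map ((↑) : ℝ≥0 → ℝ) := by
  have h : (entryLaw γ).map (Preorder.frestrictLe 0) = (γ.map ((↑) : ℝ≥0 → ℝ)).map
      (MeasurableEquiv.piUnique fun _ : Finset.Iic 0 => ℝ).symm := by
    unfold entryLaw
    rw [Kernel.trajMeasure, Measure.map_comp _ _ (by fun_prop), Kernel.traj_map_frestrictLe,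
      Kernel.partialTraj_self, Measure.id_comp]
  have h' : (fun x : ℕ → ℝ => x 0) =
      MeasurableEquiv.piUnique (fun _ : Finset.Iic 0 => ℝ) ∘ Preorder.frestrictLe 0 := by
    ext x
    rfl
  rw [h', ← Measure.map_map (by fun_prop) (by fun_prop), h, Measure.map_map (by fun_prop)
    (by fun_prop), MeasurableEquiv.self_comp_symm, Measure.map_id]

theorem ae_entryLaw_step {t : ℕ} {P : ((Finset.Iic t → ℝ) × ℝ) → Prop}
    (hP : MeasurableSet {p | P p}) (h : ∀ a, ∀ᵐ y ∂stepKernel γ t a, P (a, y)) :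
    ∀ᵐ x ∂entryLaw γ, P (Preorder.frestrictLe t x, x (t + 1)) := by
  have h1 := Measure.ae_compProd_of_ae_ae (μ := (entryLaw γ).map (Preorder.frestrictLe t)) hP
    (Eventually.of_forall h)
  rw [map_compProd_stepKernel] at h1
  exact ae_of_ae_map (by fun_prop) h1

theorem ae_entryLaw_of_entryKernel {t i j : ℕ} (hij : i < j) (ht : entryIndex i j = t + 1)
    {P : ((ℕ → ℕ → ℝ) × ℝ) → Prop} (hP : MeasurableSet {p | P p})
    (h : ∀ q, ∀ᵐ y ∂entryKernel γ i j q, P (q, y)) :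
    ∀ᵐ x ∂entryLaw γ, P (fragment t (Preorder.frestrictLe t x), toMatrix x i j) := by
  simp only [toMatrix_of_lt _ hij, ht]
  refine ae_entryLaw_step γ (P := fun p => P (fragment t p.1, p.2))
    ((((measurable_fragment t).comp measurable_fst).prodMk measurable_snd) hP) fun a => ?_
  rw [stepKernel, Kernel.comap_apply, ← ht, entryAt_entryIndex hij]
  exact h _

theorem exists_entryIndex_eq_succ (i : ℕ) {j : ℕ} (hj : 2 ≤ j) : ∃ t, entryIndex i j = t + 1 := by
  have := entryIndex_zero_pos hj
  rw [entryIndex_eq]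
  exact Nat.exists_eq_add_one.2 (by omega)

theorem ae_toMatrix_zero_nonneg : ∀ᵐ x ∂entryLaw γ, ∀ j, 0 ≤ toMatrix x 0 j := by
  refine ae_all_iff.2 fun j => ?_
  rcases Nat.lt_or_ge j 2 with hj | hj
  · interval_cases j
    · simp [toMatrix_self]
    · have h := ae_map_coe_nonneg γ
      rw [← map_eval_zero_entryLaw γ] at h
      exact ae_of_ae_map (measurable_pi_apply 0).aemeasurable h
  · obtain ⟨t, ht⟩ := exists_entryIndex_eq_succ 0 hj
    exact ae_entryLaw_of_entryKernel γ (P := fun p => 0 ≤ p.2) (by omega) ht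
      (measurableSet_le measurable_const measurable_snd) fun q => ae_map_coe_nonneg γ

theorem ae_toMatrix_mem_segment : ∀ᵐ x ∂entryLaw γ, ∀ k j, k + 1 < j →
    lower k j (toMatrix x) ≤ upper k j (toMatrix x) →
    lower k j (toMatrix x) ≤ toMatrix x (k + 1) j ∧
      toMatrix x (k + 1) j ≤ upper k j (toMatrix x) := by
  refine ae_all_iff.2 fun k => ae_all_iff.2 fun j => ae_all_iff.2 fun hkj => ?_
  obtain ⟨t, ht⟩ := exists_entryIndex_eq_succ (k + 1) (show 2 ≤ j by omega)
  have hl : Measurable fun p : (ℕ → ℕ → ℝ) × ℝ => lower k j p.1 :=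
    (measurable_bounds k j).fst.comp measurable_fst
  have hu : Measurable fun p : (ℕ → ℕ → ℝ) × ℝ => upper k j p.1 :=
    (measurable_bounds k j).snd.comp measurable_fst
  have h := ae_entryLaw_of_entryKernel γ (P := fun p => lower k j p.1 ≤ upper k j p.1 →
    lower k j p.1 ≤ p.2 ∧ p.2 ≤ upper k j p.1) hkj ht
    ((measurableSet_le hl hu).imp ((measurableSet_le hl measurable_snd).inter
      (measurableSet_le measurable_snd hu))) fun q => ae_unif_mem_Icc _ _
  filter_upwards [h] with x hx
  rwa [lower_fragment x hkj ht, upper_fragment x hkj ht] at hx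

theorem ae_toMatrix_mem_distCone : ∀ᵐ x ∂entryLaw γ, toMatrix x ∈ distCone := by
  filter_upwards [ae_toMatrix_zero_nonneg γ, ae_toMatrix_mem_segment γ] with x h0 hseg
  exact mem_distCone_of_mem_segment (toMatrix_self x) (toMatrix_comm x) h0 hseg

theorem ae_toMatrix_zero_ne [NullSingletonClass γ] :
    ∀ᵐ x ∂entryLaw γ, ∀ i j, i < j → toMatrix x 0 i ≠ toMatrix x 0 j := by
  have := nullSingletonClass_map_coe γ
  refine ae_all_iff.2 fun i => ae_all_iff.2 fun j => ae_all_iff.2 fun hij => ?_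
  rcases Nat.lt_or_ge j 2 with hj | hj
  -- The entry `(0, 1)` is the initial one and is not produced by any step kernel.
  · obtain rfl : j = 1 := by omega
    obtain rfl : i = 0 := by omega
    have h := Measure.ae_ne (γ.map ((↑) : ℝ≥0 → ℝ)) 0
    rw [← map_eval_zero_entryLaw γ] at h
    filter_upwards [ae_of_ae_map (measurable_pi_apply 0).aemeasurable h] with x hx
    rw [toMatrix_self]
    exact hx.symm
  · obtain ⟨t, ht⟩ := exists_entryIndex_eq_succ 0 hj
    have h := ae_entryLaw_of_entryKernel γ (P := fun p => p.1 0 i ≠ p.2) (by omega) ht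
      (measurableSet_eq_fun (f := fun p : (ℕ → ℕ → ℝ) × ℝ => p.1 0 i) (by fun_prop)
        measurable_snd).compl
      fun q => by
        filter_upwards [Measure.ae_ne (γ.map ((↑) : ℝ≥0 → ℝ)) (q 0 i)] with y hy using hy.symm
    filter_upwards [h] with x hx
    rcases Nat.eq_zero_or_pos i with rfl | hi
    · rw [toMatrix_self]
      simpa [fragment, toMatrix_self] using hx
    · rwa [fragment_frestrictLe x hi] at hx
      have := entryIndex_lt_entryIndex_zero hi hij
      omega

end Law

/-! ### Approximation of a vector by the columns -/

/-- The filtration generated by the entries. -/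
def entryFiltration : Filtration ℕ (inferInstance : MeasurableSpace (ℕ → ℝ)) :=
  Filtration.piLE (X := fun _ => ℝ)

theorem measurable_eval_entryFiltration {t u : ℕ} (hu : u ≤ t) :
    Measurable[entryFiltration t] fun x : ℕ → ℝ => x u := by
  rw [entryFiltration, Filtration.piLE_eq_comap_frestrictLe]
  exact (measurable_pi_apply (⟨u, Finset.mem_Iic.2 hu⟩ : Finset.Iic t)).comp
    (comap_measurable (Preorder.frestrictLe (π := fun _ => ℝ) t))

theorem measurable_toMatrix_column {t i m : ℕ} (hi : i < m) (ht : entryIndex i m ≤ t) :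
    Measurable[entryFiltration t] fun x : ℕ → ℝ => toMatrix x i m := by
  simp only [toMatrix_of_lt _ hi]
  exact measurable_eval_entryFiltration ht

theorem measurable_toMatrix_entry {t i j m : ℕ} (hi : i < m) (hj : j < m)
    (hm : entryIndex 0 m ≤ t + 1) :
    Measurable[entryFiltration t] fun x : ℕ → ℝ => toMatrix x i j := by
  rcases lt_trichotomy i j with hij | rfl | hij
  · have := entryIndex_lt_entryIndex_zero hij hj
    exact measurable_toMatrix_column hij (by omega)
  · simp only [toMatrix_self]
    exact measurable_const
  · simp only [toMatrix_comm _ i j]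
    have := entryIndex_lt_entryIndex_zero hij hi
    exact measurable_toMatrix_column hij (by omega)

/-- The σ-algebra is left arbitrary so that it can be a member of the filtration, for which only the
entries already chosen are known to be measurable. -/
theorem measurableSet_preimage_columnNear {α : Type*} [MeasurableSpace α] {f : α → ℕ → ℕ → ℝ}
    {n m : ℕ} (b : ℕ → ℝ) (η : ℝ) (h : ∀ i < n, Measurable fun x => f x i m) :
    MeasurableSet (f ⁻¹' columnNear n m b η) := by
  have : f ⁻¹' columnNear n m b η =
      ⋂ i, ⋂ (_ : i < n), {x | |f x i m - b i| ≤ tolerance η i} := by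
    ext x
    simp [columnNear]
  rw [this]
  refine MeasurableSet.iInter fun i => MeasurableSet.iInter fun hi => ?_
  exact measurableSet_le ((h i hi).sub_const _).abs measurable_const

theorem measurableSet_preimage_nearAdmissible {α : Type*} [MeasurableSpace α]
    {f : α → ℕ → ℕ → ℝ} {n : ℕ} (b : ℕ → ℝ) (η : ℝ)
    (h : ∀ i < n, ∀ j < n, Measurable fun x => f x i j) :
    MeasurableSet (f ⁻¹' nearAdmissible n b η) := by
  have : f ⁻¹' nearAdmissible n b η =
      ⋂ i, ⋂ (_ : i < n), ⋂ j, ⋂ (_ : j < n), ({x | |b i - b j| ≤ f x i j + 2 * η} ∩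
        {x | f x i j ≤ b i + b j + 2 * η}) := by
    ext x
    simp [nearAdmissible]
  rw [this]
  refine MeasurableSet.iInter fun i => MeasurableSet.iInter fun hi => MeasurableSet.iInter fun j =>
    MeasurableSet.iInter fun hj => ?_
  exact (measurableSet_le measurable_const ((h i hi j hj).add_const _)).inter
    (measurableSet_le (h i hi j hj) measurable_const)

theorem measurableSet_columnNear (n m : ℕ) (b : ℕ → ℝ) (η : ℝ) :
    MeasurableSet (columnNear n m b η) :=
  measurableSet_preimage_columnNear (f := id) b η fun _ _ => by simp only [id]; fun_prop

theorem measurableSet_nearAdmissible (n : ℕ) (b : ℕ → ℝ) (η : ℝ) :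
    MeasurableSet (nearAdmissible n b η) :=
  measurableSet_preimage_nearAdmissible (f := id) b η fun _ _ _ _ => by simp only [id]; fun_prop

/-- A lower bound for the conditional probability that the `i`-th entry of a column approximates
`b i` when the preceding entries approximate the preceding values. -/
def columnBound (γ : Measure ℝ≥0) (b : ℕ → ℝ) (η : ℝ) : ℕ → ℝ≥0∞
  | 0 => γ.map ((↑) : ℝ≥0 → ℝ) (Metric.closedBall (b 0) η)
  | k + 1 => ENNReal.ofReal (η / (η + (2 * b 0 + b (k + 1) + 3 * η)))

theorem columnBound_pos (γ : Measure ℝ≥0) [γ.IsOpenPosMeasure] {b : ℕ → ℝ} {η : ℝ} (hη : 0 < η)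
    (hb : ∀ i, 0 ≤ b i) (k : ℕ) : 0 < columnBound γ b η k := by
  rcases k with _ | k
  · rw [columnBound, Measure.map_apply (by fun_prop) measurableSet_closedBall]
    have h : (((↑) : ℝ≥0 → ℝ) ⁻¹' Metric.ball (b 0) η).Nonempty :=
      ⟨⟨b 0, hb 0⟩, Metric.mem_ball_self hη⟩
    exact ((Metric.isOpen_ball.preimage NNReal.continuous_coe).measure_pos γ h).trans_le
      (measure_mono (preimage_mono Metric.ball_subset_closedBall))
  · have := hb 0
    have := hb (k + 1)
    rw [columnBound, ENNReal.ofReal_pos]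
    positivity

theorem columnBound_le_entryKernel (γ : Measure ℝ≥0) {n m k : ℕ} {b : ℕ → ℝ} {η : ℝ}
    {r : ℕ → ℕ → ℝ} (hη : 0 < η) (hr : r ∈ distCone) (hb : r ∈ nearAdmissible n b η) (hk : k < n)
    (hm : r ∈ columnNear k m b η) :
    columnBound γ b η k ≤ entryKernel γ k m r (Metric.closedBall (b k) (tolerance η k)) := by
  rcases k with _ | k
  · simp [columnBound, entryKernel, tolerance]
  · obtain ⟨c, hc, hcb⟩ := exists_mem_segment_near hη hr hb hk hm
    refine (le_unif_closedBall hc hη (upper_sub_lower_le hb hk hm)).trans ?_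
    refine measure_mono (Metric.closedBall_subset_closedBall' ?_)
    rw [Real.dist_eq]
    linarith

section Law

variable (γ : Measure ℝ≥0) [IsProbabilityMeasure γ]

/-- Integrate the conditional bound over `A`, an event decided by time `t`. The bound is required
only almost surely because it will rely on the triangle inequality. -/
theorem mul_measure_le_of_le_entryKernel {t i j : ℕ} (hij : i < j) (ht : entryIndex i j = t + 1)
    {A : Set (ℕ → ℝ)} (hA : MeasurableSet[entryFiltration t] A) {B : Set ℝ} (hB : MeasurableSet B)
    {c : ℝ≥0∞} (hc : ∀ᵐ x ∂entryLaw γ, x ∈ A → c ≤ entryKernel γ i j (toMatrix x) B) :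
    c * entryLaw γ A ≤ entryLaw γ (A ∩ {x | toMatrix x i j ∈ B}) := by
  have hA' := entryFiltration.le t _ hA
  rw [entryFiltration, Filtration.piLE_eq_comap_frestrictLe] at hA
  obtain ⟨H, hH, rfl⟩ := hA
  have h1 : entryLaw γ (Preorder.frestrictLe t ⁻¹' H ∩ {x | toMatrix x i j ∈ B}) =
      (entryLaw γ).map (fun x => (Preorder.frestrictLe t x, x (t + 1))) (H ×ˢ B) := by
    rw [Measure.map_apply (by fun_prop) (hH.prod hB)]
    simp only [toMatrix_of_lt _ hij, ht]
    rfl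
  rw [h1, ← map_compProd_stepKernel, Measure.compProd_apply_prod hH hB,
    setLIntegral_map hH (Kernel.measurable_coe _ hB) (by fun_prop), ← setLIntegral_const]
  refine setLIntegral_mono_ae' hA' ?_
  filter_upwards [hc] with x hx hxA
  rw [stepKernel_frestrictLe γ x hij ht]
  exact hx hxA

theorem prod_mul_measure_le_columnNear {t n m : ℕ} (hnm : n ≤ m) (ht : entryIndex 0 m = t + 1)
    {b : ℕ → ℝ} {η : ℝ} (hη : 0 < η) {A : Set (ℕ → ℝ)} (hA : MeasurableSet[entryFiltration t] A)
    (hAb : A ⊆ toMatrix ⁻¹' nearAdmissible n b η) {k : ℕ} (hk : k ≤ n) :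
    (∏ i ∈ Finset.range k, columnBound γ b η i) * entryLaw γ A ≤
      entryLaw γ (A ∩ toMatrix ⁻¹' columnNear k m b η) := by
  induction k with
  | zero => simp [columnNear]
  | succ k ih =>
    have htk : entryIndex k m = t + k + 1 := by rw [entryIndex_eq]; omega
    have hcol : MeasurableSet[entryFiltration (t + k)] (toMatrix ⁻¹' columnNear k m b η) :=
      @measurableSet_preimage_columnNear _ (entryFiltration _) _ _ _ b η fun i hi =>
        measurable_toMatrix_column (by omega) (by rw [entryIndex_eq]; omega)
    have hAk := MeasurableSet.inter (entryFiltration.mono (Nat.le_add_right t k) _ hA) hcol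
    have hstep := mul_measure_le_of_le_entryKernel γ (c := columnBound γ b η k)
      (show k < m by omega) htk hAk
      (measurableSet_closedBall (x := b k) (ε := tolerance η k)) (by
        filter_upwards [ae_toMatrix_mem_distCone γ] with x hx hxA
        exact columnBound_le_entryKernel γ hη hx (hAb hxA.1) hk hxA.2)
    rw [Finset.prod_range_succ, mul_comm (∏ i ∈ _, _), mul_assoc]
    refine (mul_le_mul_right (ih (by omega)) _).trans (hstep.trans (measure_mono ?_))
    rintro x ⟨⟨hxA, hx⟩, hxk⟩
    refine ⟨hxA, fun i hi => ?_⟩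
    rcases Nat.lt_succ_iff_lt_or_eq.1 hi with hi | rfl
    · exact hx i hi
    · simpa [Real.dist_eq] using hxk

theorem ae_exists_columnNear [γ.IsOpenPosMeasure] (n : ℕ) {b : ℕ → ℝ} {η : ℝ} (hη : 0 < η)
    (hb : ∀ i, 0 ≤ b i) : ∀ᵐ x ∂entryLaw γ, toMatrix x ∈ nearAdmissible n b η →
      ∃ m, toMatrix x ∈ columnNear n m b η := by
  -- From column `n` on, the corner is complete and the first `n` rows lie above the diagonal; from
  -- column `2` on, a column starts at a positive time.
  set M := max n 2
  set p := ∏ i ∈ Finset.range n, columnBound γ b η i with hp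
  have hp0 : p ≠ 0 := Finset.prod_ne_zero_iff.2 fun i _ => (columnBound_pos γ hη hb i).ne'
  let D : ℕ → Set (ℕ → ℝ) := fun N => toMatrix ⁻¹' nearAdmissible n b η ∩
    ⋂ l, ⋂ (_ : l < N), (toMatrix ⁻¹' columnNear n (M + l) b η)ᶜ
  have hD : ∀ N, entryLaw γ (D N) ≤ (1 - p) ^ N := fun N => by
    induction N with
    | zero => simpa using prob_le_one
    | succ N ih =>
      obtain ⟨t, ht⟩ := exists_entryIndex_eq_succ 0 (show 2 ≤ M + N by omega)
      -- Failure of the columns before `M + N` is decided before that column starts.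
      have hDm : MeasurableSet[entryFiltration t] (D N) := by
        refine MeasurableSet.inter
          (@measurableSet_preimage_nearAdmissible _ (entryFiltration _) _ _ b η
            fun i hi j hj => measurable_toMatrix_entry (m := M + N) (by omega) (by omega) ht.le)
          (MeasurableSet.iInter fun l => MeasurableSet.iInter fun hl =>
            (@measurableSet_preimage_columnNear _ (entryFiltration _) _ _ _ b η fun i hi =>
              measurable_toMatrix_entry (m := M + N) (by omega) (by omega) ht.le).compl)
      have hle := prod_mul_measure_le_columnNear γ (show n ≤ M + N by omega) ht hη hDm
        inter_subset_left le_rfl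
      rw [← hp] at hle
      have hsub : D (N + 1) = D N \ (D N ∩ toMatrix ⁻¹' columnNear n (M + N) b η) := by
        rw [sdiff_self_inter]
        ext x
        simp only [D, mem_inter_iff, mem_iInter, Set.mem_sdiff, mem_compl_iff,
          Nat.lt_succ_iff_lt_or_eq, or_imp, forall_and, forall_eq, and_assoc]
      rw [hsub, measure_sdiff inter_subset_left ((entryFiltration.le t _ hDm).inter
        (measurable_toMatrix (measurableSet_columnNear _ _ _ _))).nullMeasurableSet
        (measure_ne_top _ _)]
      calc entryLaw γ (D N) - entryLaw γ (D N ∩ toMatrix ⁻¹' columnNear n (M + N) b η)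
          ≤ entryLaw γ (D N) - p * entryLaw γ (D N) := tsub_le_tsub_left hle _
        _ = (1 - p) * entryLaw γ (D N) := by
          rw [ENNReal.sub_mul fun _ _ => measure_ne_top _ _, one_mul]
        _ ≤ (1 - p) * (1 - p) ^ N := by gcongr
        _ = (1 - p) ^ (N + 1) := (pow_succ' _ _).symm
  have hlim : Tendsto (fun N : ℕ => (1 - p) ^ N) atTop (𝓝 0) :=
    ENNReal.tendsto_pow_atTop_nhds_zero_of_lt_one
      (ENNReal.sub_lt_self ENNReal.one_ne_top one_ne_zero hp0)
  rw [ae_iff]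
  refine le_antisymm (ge_of_tendsto' hlim fun N => (measure_mono fun x hx => ?_).trans (hD N))
    zero_le
  simp only [mem_ofPred_eq, Classical.not_imp, not_exists] at hx
  exact ⟨hx.1, mem_iInter.2 fun l => mem_iInter.2 fun _ => hx.2 _⟩

/-! ### The measure on the cone -/

theorem isProbabilityMeasure_nu : IsProbabilityMeasure (nu γ) := by
  refine ⟨?_⟩
  rw [nu, (MeasurableEmbedding.subtype_coe measurableSet_distCone).comap_apply, image_univ,
    Subtype.range_coe, Measure.map_apply measurable_toMatrix measurableSet_distCone]
  exact (mem_ae_iff_prob_eq_one (measurable_toMatrix measurableSet_distCone)).1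
    (ae_toMatrix_mem_distCone γ)

theorem ae_nu_of_ae_entryLaw {P : (ℕ → ℕ → ℝ) → Prop} (hP : MeasurableSet {q | P q})
    (h : ∀ᵐ x ∂entryLaw γ, P (toMatrix x)) : ∀ᵐ r ∂nu γ, P r.1 := by
  rw [← ae_map_iff measurable_toMatrix.aemeasurable hP, ae_iff] at h
  rw [ae_iff, nu, (MeasurableEmbedding.subtype_coe measurableSet_distCone).comap_apply]
  exact measure_mono_null (by rintro _ ⟨r, hr, rfl⟩; exact hr) h

/-- A zero at `(i, j)` would force `r 0 i = r 0 j` by the triangle inequality. -/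
theorem ae_nu_isProper [NullSingletonClass γ] : ∀ᵐ r ∂nu γ, IsProper r := by
  have h := ae_nu_of_ae_entryLaw γ (P := fun q => ∀ i j, i < j → q 0 i ≠ q 0 j)
    (by
      simp only [ofPred_forall]
      exact MeasurableSet.iInter fun i => MeasurableSet.iInter fun j => MeasurableSet.iInter
        fun _ => (measurableSet_eq_fun (by fun_prop) (by fun_prop)).compl)
    (ae_toMatrix_zero_ne γ)
  filter_upwards [h] with r hr i j hij h0
  obtain ⟨-, -, hcomm, htri⟩ := r.2
  have h0' : r.1 j i = 0 := by rw [hcomm, h0]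
  have h1 := htri 0 i j
  have h2 := htri 0 j i
  rw [h0'] at h1
  rw [h0] at h2
  have h3 : r.1 0 i = r.1 0 j := by linarith
  rcases hij.lt_or_gt with hij | hij
  · exact hr i j hij h3
  · exact hr j i hij h3.symm

theorem ae_nu_isUniversal [γ.IsOpenPosMeasure] : ∀ᵐ r ∂nu γ, IsUniversal r := by
  have h : ∀ (n : ℕ) (b : Fin n → ℚ≥0) (N : ℕ), ∀ᵐ r ∂nu γ,
      r.1 ∈ nearAdmissible n (fun i => if hi : i < n then ((b ⟨i, hi⟩ : ℚ≥0) : ℝ) else 0)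
        (1 / (N + 1)) → ∃ m, r.1 ∈ columnNear n m
        (fun i => if hi : i < n then ((b ⟨i, hi⟩ : ℚ≥0) : ℝ) else 0) (1 / (N + 1)) := by
    intro n b N
    refine ae_nu_of_ae_entryLaw γ (P := fun q => q ∈ nearAdmissible n _ _ →
      ∃ m, q ∈ columnNear n m _ _) ?_ (ae_exists_columnNear γ n (by positivity) fun i => ?_)
    · refine (measurableSet_nearAdmissible n _ _).imp ?_
      rw [ofPred_exists]
      exact MeasurableSet.iUnion fun m => measurableSet_columnNear n m _ _
    · split_ifs <;> positivity
  filter_upwards [ae_all_iff.2 fun n => ae_all_iff.2 fun b => ae_all_iff.2 (h n b)] with r hr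
  exact isUniversal_of_nearAdmissible hr

end Law

end RandomMetric

end

theorem theorem4 (γ : Measure ℝ≥0) [IsProbabilityMeasure γ] [NullSingletonClass γ]
    [Measure.IsOpenPosMeasure γ] :
    IsProbabilityMeasure (RandomMetric.nu γ) ∧
    (∀ᵐ r ∂(RandomMetric.nu γ), RandomMetric.IsProper r ∧ RandomMetric.IsUniversal r) ∧
    (∀ᵐ r ∂(RandomMetric.nu γ), RandomMetric.IsUrysohn (RandomMetric.Completed r) ∧
      ∀ (U : Type*) [MetricSpace U], RandomMetric.IsUrysohn U →
        Nonempty (RandomMetric.Completed r ≃ᵢ U)) := by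
  refine ⟨RandomMetric.isProbabilityMeasure_nu γ,
    (RandomMetric.ae_nu_isProper γ).and (RandomMetric.ae_nu_isUniversal γ), ?_⟩
  filter_upwards [RandomMetric.ae_nu_isUniversal γ] with r hr
  exact ⟨hr.isUrysohn, fun U _ hU => hr.isUrysohn.nonempty_isometryEquiv hU⟩
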